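/- Let $(Y_i,X_i,Z_i)_{i\ge 1}$ be i.i.d. with values in $\mathbb R\times\mathbb R^{d_x}\times\mathbb R^{d_z}$, let $\theta_0=(\alpha_0,\beta_0',\gamma_0')'$ with $\alpha_0\in\mathbb R$, $\beta_0\in\mathbb R^{d_z}$, $\gamma_0\in\mathbb R^{d_x}$, and let $$Y_i=\alpha_0+Z_i'\beta_0+X_i'\gamma_0+\varepsilon_i .$$ Let $\mathcal Z$ be the support of $Z_i$, let $\pi_0(z)=\mathbb E[X_i\mid Z_i=z]$, and let $W_i=(1,Z_i',\pi_0(Z_i)')'$. Assume: 1. (Mean independence) $\mathbb E[\varepsilon_i\mid Z_i]=0$ almost surely. 2. (No multicollinearity) $\mathbb E[W_iW_i']$ has full rank. 3. (Fourth moments) $\mathbb E|\varepsilon_i|^4$, $\mathbb E\|X_i\|^4$ and $\mathbb E\|Z_i\|^4$ are finite. 4. (Smoothness and nonparametric convergence) For some $s>d_z/2$, the components of $\pi_0$ lie in the Sobolev space $H^s(\mathcal Z)$, that is, the space of restrictions to $\mathcal Z$ of continuous representatives of functions in $H^s(\mathbb R^{d_z})$, with the quotient norm. The first-stage estimators $\hat\pi=\hat\pi_n$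 are random functions $\mathbb R^{d_z}\to\mathbb R^{d_x}$ whose components belong to $H^s(\mathcal Z)$ with probability approaching $1$, with norms bounded in probability, $\|\hat\pi_k\|_{H^s(\mathcal Z)}=O_p(1)$ (for instance, they lie in a fixed ball of $H^s(\mathcal Z)$ with probability approaching $1$). Moreover $\|\hat\pi-\pi_0\|_{L_2(Z)}=o_p(n^{-1/4})$, where $\|f\|_{L_2(Z)}^2=\int\|f(z)\|^2\,dP_{Z}(z)$ and $P_Z$ is the law of $Z_i$. Put $\hat W_i=(1,Z_i',\hat\pi(Z_i)')'$ and $$\hat\Sigma=\frac1n\sum_{i=1}^n\hat W_i\hat W_i',\qquad \hat\theta=(\hat\alpha,\hat\beta',\hat\gamma')'=\hat\Sigma^{-1}\frac1n\sum_{i=1}^n\hat W_iY_i,$$ $$\hat\varepsilon_i=Y_i-\hat\alpha-Z_i'\hat\beta-X_i'\hat\gamma,\qquad \hat\Omega=\frac1n\sum_{i=1}^n\hat\varepsilon_i^2\hat W_i\hat W_i',$$ and let $V_0=\mathbb E[W_iW_i']^{-1}\,\mathbb E[\varepsilon_i^2W_iW_i']\,\mathbb E[W_iW_i']^{-1}$.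 Then, as $n\to\infty$, $$\hat V:=\hat\Sigma^{-1}\hat\Omega\hat\Sigma^{-1}\ \xrightarrow{\,p\,}\ V_0 .$$ If moreover $\mathbb E[\varepsilon_i^2\mid Z_i]=\sigma_\varepsilon^2$ almost surely for a constant $\sigma_\varepsilon^2$ (homoskedasticity), then also $$\Big(\frac1n\sum_{i=1}^n\hat\varepsilon_i^2\Big)\hat\Sigma^{-1}\ \xrightarrow{\,p\,}\ V_0 .$$ -/

import Mathlib

open MeasureTheory ProbabilityTheory Filter Topology
open scoped ENNReal NNReal

noncomputable section

/-- `ℝ^d` with its Euclidean norm. -/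
abbrev Vec (d : ℕ) : Type := EuclideanSpace ℝ (Fin d)

/-- Index set of `θ = (α, β', γ')'`: one intercept, `dz` slopes on `Z`, `dx` slopes on `X`. -/
abbrev Coef (dz dx : ℕ) : Type := Unit ⊕ Fin dz ⊕ Fin dx

/-- The vector `(1, z', x')'`. -/
def stack {dz dx : ℕ} (z : Vec dz) (x : Vec dx) : Coef dz dx → ℝ :=
  Sum.elim (fun _ => 1) (Sum.elim (fun j => z j) (fun k => x k))

/-- The residual `y - α - z'β - x'γ` at the coefficient vector `θ = (α, β', γ')'`. -/
def regResidual {dz dx : ℕ} (θ : Coef dz dx → ℝ) (y : ℝ) (x : Vec dx) (z : Vec dz) : ℝ :=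
  y - θ (Sum.inl ()) - (∑ j, z j * θ (Sum.inr (Sum.inl j)))
    - ∑ k, x k * θ (Sum.inr (Sum.inr k))

/-! ### Sobolev spaces on a subset of `ℝ^d` -/

/-- The norm of the Sobolev space `H^s(S)`, `S ⊆ ℝ^d`, of restrictions to `S` of functions in
`H^s(ℝ^d)`, for `s > d / 2`: the infimum of `‖F‖_{H^s} = ‖(1 - (2π)⁻²Δ)^{s/2} F‖_{L²}` over all
extensions `F` of `f` in `H^s(ℝ^d)`; it is `∞` if there is no such extension.
Since `s > d / 2`, an element of `H^s(ℝ^d)` has exactly one continuous representative, and `F` runs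
through these. The values are complex because Mathlib's tempered distributions are; the real
part of an extension is an extension with no larger norm. -/
def sobolevNormOn {d : ℕ} (s : ℝ) (S : Set (Vec d)) (f : Vec d → ℝ) : ℝ≥0∞ :=
  ⨅ (F : Vec d → ℂ) (_ : Continuous F) (_ : ∀ z ∈ S, F z = (f z : ℂ))
    (hF : MemLp F 2 volume) (v : Lp ℂ 2 (volume : Measure (Vec d)))
    (_ : TemperedDistribution.besselPotential (Vec d) ℂ s
        (Lp.toTemperedDistribution (hF.toLp F)) = Lp.toTemperedDistribution v),
    ‖v‖ₑ

/-! ### Stochastic orders (no measurability of the sequences is needed) -/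

section Asymptotics

variable {Ω : Type*} [MeasurableSpace Ω]

/-- `R_n = O_p(1)`. -/
def BoundedInProb (P : Measure Ω) (R : ℕ → Ω → ℝ≥0∞) : Prop :=
  ∀ δ : ℝ≥0∞, 0 < δ → ∃ M : ℝ≥0, ∀ᶠ n in atTop, P {ω | (M : ℝ≥0∞) < R n ω} ≤ δ

/-- `R_n = o_p(r_n)`, for a deterministic rate `r_n`. -/
def IsLittleOInProb (P : Measure Ω) (R : ℕ → Ω → ℝ≥0∞) (r : ℕ → ℝ) : Prop :=
  ∀ δ : ℝ, 0 < δ → Tendsto (fun n => P {ω | ENNReal.ofReal (δ * r n) < R n ω}) atTop (𝓝 0)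

/-- Convergence in probability of random matrices to a deterministic matrix, entry by entry. -/
def MatrixTendstoInProb {ι : Type*} (P : Measure Ω) (A : ℕ → Ω → Matrix ι ι ℝ)
    (B : Matrix ι ι ℝ) : Prop :=
  ∀ a b, TendstoInMeasure P (fun n ω => A n ω a b) atTop (fun _ => B a b)

end Asymptotics

/-! ### Population quantities; `W = (1, Z', π₀(Z)')'` -/

section Population

variable {Ω : Type*} [MeasurableSpace Ω] {dz dx : ℕ}

/-- `Σ₀ = E[W W']`. -/
def popSigma (P : Measure Ω) (Z : Ω → Vec dz) (π₀ : Vec dz → Vec dx) :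
    Matrix (Coef dz dx) (Coef dz dx) ℝ :=
  Matrix.of fun a b => ∫ ω, stack (Z ω) (π₀ (Z ω)) a * stack (Z ω) (π₀ (Z ω)) b ∂P

/-- `Ω₀ = E[ε² W W']`. -/
def popOmega (P : Measure Ω) (ε : Ω → ℝ) (Z : Ω → Vec dz) (π₀ : Vec dz → Vec dx) :
    Matrix (Coef dz dx) (Coef dz dx) ℝ :=
  Matrix.of fun a b =>
    ∫ ω, ε ω ^ 2 * (stack (Z ω) (π₀ (Z ω)) a * stack (Z ω) (π₀ (Z ω)) b) ∂P

/-- `V₀ = E[W W']⁻¹ E[ε² W W'] E[W W']⁻¹`. -/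
def popV (P : Measure Ω) (ε : Ω → ℝ) (Z : Ω → Vec dz) (π₀ : Vec dz → Vec dx) :
    Matrix (Coef dz dx) (Coef dz dx) ℝ :=
  (popSigma P Z π₀)⁻¹ * popOmega P ε Z π₀ * (popSigma P Z π₀)⁻¹

end Population

/-! ### Sample quantities, as functions of the data `y, x, z`, of which the first `n` observations
are used, and of the fitted first stage `p` (the value of `π̂`); `Ŵᵢ = (1, zᵢ', p(zᵢ)')'` -/

section Sample

variable {dz dx : ℕ}

/-- `Σ̂ = n⁻¹ ∑ Ŵᵢ Ŵᵢ'`. -/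
def sigmaHat (n : ℕ) (z : ℕ → Vec dz) (p : Vec dz → Vec dx) :
    Matrix (Coef dz dx) (Coef dz dx) ℝ :=
  (n : ℝ)⁻¹ • ∑ i ∈ Finset.range n,
    Matrix.vecMulVec (stack (z i) (p (z i))) (stack (z i) (p (z i)))

/-- `θ̂ = (α̂, β̂', γ̂')' = Σ̂⁻¹ n⁻¹ ∑ Ŵᵢ yᵢ`. -/
def thetaHat (n : ℕ) (y : ℕ → ℝ) (z : ℕ → Vec dz) (p : Vec dz → Vec dx) : Coef dz dx → ℝ :=
  (sigmaHat n z p)⁻¹.mulVec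
    ((n : ℝ)⁻¹ • ∑ i ∈ Finset.range n, y i • stack (z i) (p (z i)))

/-- `ε̂ᵢ = yᵢ - α̂ - zᵢ'β̂ - xᵢ'γ̂`. -/
def epsHat (n : ℕ) (y : ℕ → ℝ) (x : ℕ → Vec dx) (z : ℕ → Vec dz) (p : Vec dz → Vec dx)
    (i : ℕ) : ℝ :=
  regResidual (thetaHat n y z p) (y i) (x i) (z i)

/-- `Ω̂ = n⁻¹ ∑ ε̂ᵢ² Ŵᵢ Ŵᵢ'`. -/
def omegaHat (n : ℕ) (y : ℕ → ℝ) (x : ℕ → Vec dx) (z : ℕ → Vec dz) (p : Vec dz → Vec dx) :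
    Matrix (Coef dz dx) (Coef dz dx) ℝ :=
  (n : ℝ)⁻¹ • ∑ i ∈ Finset.range n, epsHat n y x z p i ^ 2 •
    Matrix.vecMulVec (stack (z i) (p (z i))) (stack (z i) (p (z i)))

/-- The sandwich estimator `V̂ = Σ̂⁻¹ Ω̂ Σ̂⁻¹`. -/
def vHat (n : ℕ) (y : ℕ → ℝ) (x : ℕ → Vec dx) (z : ℕ → Vec dz) (p : Vec dz → Vec dx) :
    Matrix (Coef dz dx) (Coef dz dx) ℝ :=
  (sigmaHat n z p)⁻¹ * omegaHat n y x z p * (sigmaHat n z p)⁻¹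

/-- The estimator `(n⁻¹ ∑ ε̂ᵢ²) Σ̂⁻¹` used under homoskedasticity. -/
def vHatHom (n : ℕ) (y : ℕ → ℝ) (x : ℕ → Vec dx) (z : ℕ → Vec dz) (p : Vec dz → Vec dx) :
    Matrix (Coef dz dx) (Coef dz dx) ℝ :=
  ((n : ℝ)⁻¹ * ∑ i ∈ Finset.range n, epsHat n y x z p i ^ 2) • (sigmaHat n z p)⁻¹

end Sample

end

/-! Since `s > d / 2`, a ball of `H^s` is uniformly bounded and equicontinuous. The Fourier
transform of such an `F` is the square-integrable weight `(1 + ‖ξ‖²)^(-s/2)` times an `L²` function,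
so `F` is an absolutely convergent Fourier integral, and Cauchy-Schwarz bounds both `F` and its
increments (`sobolev_embedding`).

In such a class the `L²(Z)` norm controls the values pointwise outside a fixed set of small
probability: a compact part of the support is covered by finitely many balls of positive mass, on
which the functions hardly vary (`exists_sq_le_integral_add`). The constants serve the whole class,
so the bound applies to a first stage fitted on the same sample, and only the frequency of one fixed
set needs a law of large numbers. Hence `π̂ - π₀` vanishes in the empirical `L⁴` norm
(`l4Null_of_equicontinuous`).

Every sample moment involved is an average of products of four factors, each close in that norm to a
function of one observation with finite fourth moment. Hölder's inequality and the law of large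
numbers give its limit (`tendsto_avg_mul_four_iid`). Since `E[W X'] = E[W π₀(Z)']` and `E[W ε] = 0`,
the estimator `θ̂` converges to `θ₀`. The residuals then approach the errors in empirical `L⁴`, and
continuity of the matrix inverse finishes (`tendsto_vHat_of_l4Null`).

Convergence in probability is treated as convergence along the filter `inProb P`. A bound in
probability becomes a genuine bound after restriction to the complement of an event of probability
at most `δ` (`tendsto_inProb_of_localized`), which avoids any measurability of `π̂`. -/

/-! ### Sobolev embedding through the Fourier transform -/

section SobolevEmbedding

open FourierTransform
open scoped SchwartzMap ContDiff

variable {E : Type*} [NormedAddCommGroup E] [InnerProductSpace ℝ E] [FiniteDimensional ℝ E]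
  [MeasurableSpace E] [BorelSpace E]

/-- Self-adjointness of the inverse Fourier transform, for a Schwartz and an integrable function. -/
theorem SchwartzMap.integral_fourierInv_smul_integrable (φ : 𝓢(E, ℂ)) {g : E → ℂ}
    (hg : Integrable g) : ∫ ξ, (𝓕⁻ φ) ξ • g ξ = ∫ x, φ x • (𝓕⁻ g) x := by
  -- The sign in `-innerₗ E` turns the Fourier integral into its inverse; the pairing is symmetric,
  -- so flipping changes nothing.
  have h := VectorFourier.integral_bilin_fourierIntegral_eq_flip (ContinuousLinearMap.mul ℂ ℂ)
    (L := -innerₗ E) (μ := volume) (ν := volume) Real.continuous_fourierChar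
    (by exact continuous_inner.neg) φ.integrable hg
  have hflip : (-innerₗ E).flip = -innerₗ E := by ext x y; simp [real_inner_comm]
  rw [hflip] at h
  simp only [smul_eq_mul, SchwartzMap.fourierInv_coe]
  exact h

/-- A continuous square-integrable function whose distributional Fourier transform is an integrable
function is pointwise the inverse Fourier integral of that function. -/
theorem eq_fourierInv_of_fourier_eq_toTemperedDistribution {F : E → ℂ} (hFc : Continuous F)
    (hF : MemLp F 2 volume) (g : Lp ℂ 1 (volume : Measure E))
    (h : 𝓕 (Lp.toTemperedDistribution (hF.toLp F)) = Lp.toTemperedDistribution g) (x : E) :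
    F x = 𝓕⁻ (g : E → ℂ) x := by
  have hg : Integrable (g : E → ℂ) := L1.integrable_coeFn g
  have hcont : Continuous (𝓕⁻ (g : E → ℂ)) := by
    have : 𝓕⁻ (g : E → ℂ) = fun w => 𝓕 (g : E → ℂ) (-w) := by
      ext w; exact Real.fourierInv_eq_fourier_neg _ _
    rw [this]
    exact (Real.Lp.fourierTransform g).continuous.comp continuous_neg
  have hae : F =ᵐ[volume] 𝓕⁻ (g : E → ℂ) := by
    apply ae_eq_of_integral_contDiff_smul_eq hFc.locallyIntegrable hcont.locallyIntegrable
    intro φ hφ hφc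
    -- Complexified, the real test function is a Schwartz function, against which the distributional
    -- identity can be evaluated.
    have hφ₁ : HasCompactSupport (Complex.ofRealCLM ∘ φ) := hφc.comp_left rfl
    have hφ₂ : ContDiff ℝ ∞ (Complex.ofRealCLM ∘ φ) := by fun_prop
    set ψ : 𝓢(E, ℂ) := hφ₁.toSchwartzMap hφ₂
    have hψ : ∀ y, ψ y = (φ y : ℂ) := fun y => rfl
    have h1 : Lp.toTemperedDistribution (hF.toLp F) = 𝓕⁻ (Lp.toTemperedDistribution g) := by
      rw [← h]; exact (fourierInv_fourier_eq _).symm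
    have h2 := congrArg (fun T : 𝓢'(E, ℂ) => T ψ) h1
    simp only [TemperedDistribution.fourierInv_apply, Lp.toTemperedDistribution_apply] at h2
    rw [ψ.integral_fourierInv_smul_integrable hg] at h2
    have h3 : ∫ y, ψ y • (hF.toLp F : E → ℂ) y = ∫ y, ψ y • F y := by
      apply integral_congr_ae
      filter_upwards [hF.coeFn_toLp] with y hy
      rw [hy]
    rw [h3] at h2
    simpa [hψ, Complex.real_smul] using h2
  exact congrFun (hFc.ae_eq_iff_eq volume hcont |>.1 hae) x

/-- The square is `(1 + ‖x‖²)^(-s)`, integrable because `2s` exceeds the dimension. This is the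
analytic use of `s > d / 2`. -/
theorem memLp_two_besselWeight {s : ℝ} (hs : Module.finrank ℝ E < 2 * s) :
    MemLp (fun x : E => ((1 + ‖x‖ ^ 2) ^ (-s / 2) : ℝ)) 2 volume := by
  have hm : AEStronglyMeasurable (fun x : E => ((1 + ‖x‖ ^ 2) ^ (-s / 2) : ℝ)) volume :=
    Measurable.aestronglyMeasurable (by fun_prop)
  rw [memLp_two_iff_integrable_sq hm]
  refine (integrable_rpow_neg_one_add_norm_sq hs).congr (ae_of_all _ fun x => ?_)
  simp only
  rw [← Real.rpow_mul_natCast (by positivity)]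
  congr 1; push_cast; ring

theorem integral_norm_mul_le_L2 {a : E → ℂ} (ha : MemLp a 2 volume)
    (u : Lp ℂ 2 (volume : Measure E)) :
    ∫ ξ, ‖a ξ‖ * ‖u ξ‖ ≤ (∫ ξ, ‖a ξ‖ ^ (2 : ℝ)) ^ (1 / 2 : ℝ) * ‖u‖ := by
  have h := integral_mul_norm_le_Lp_mul_Lq (μ := (volume : Measure E)) (p := 2) (q := 2)
    Real.HolderConjugate.two_two (f := a) (g := u) (by simpa using ha) (by simpa using Lp.memLp u)
  have hu : ‖u‖ = (∫ ξ, ‖u ξ‖ ^ (2 : ℝ)) ^ (1 / 2 : ℝ) := by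
    rw [Lp.norm_def, (Lp.memLp u).eLpNorm_eq_integral_rpow_norm (by norm_num) (by norm_num),
      ENNReal.toReal_ofReal (by positivity)]
    simp
  rwa [hu]

theorem norm_fourierChar (t : ℝ) : ‖(Real.fourierChar t : ℂ)‖ = 1 :=
  Circle.norm_coe _

/-- The modulus of continuity, in `h`, of the unit ball of `H^s`. -/
noncomputable def sobolevModulus (s : ℝ) (h : E) : ℝ :=
  (∫ ξ : E, ‖((Real.fourierChar (inner ℝ ξ h) : ℂ) - 1) *
    ((1 + ‖ξ‖ ^ 2) ^ (-s / 2) : ℝ)‖ ^ (2 : ℝ)) ^ (1 / 2 : ℝ)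

/-- Dominated convergence: the integrand is continuous in `h`, at most four times the squared
weight, and zero at `h = 0`. -/
theorem tendsto_sobolevModulus {s : ℝ} (hs : Module.finrank ℝ E < 2 * s) :
    Tendsto (sobolevModulus s : E → ℝ) (𝓝 0) (𝓝 0) := by
  have hw := (memLp_two_iff_integrable_sq (memLp_two_besselWeight hs).1).1
    (memLp_two_besselWeight hs)
  have hc : Continuous (sobolevModulus s : E → ℝ) := by
    unfold sobolevModulus
    refine Continuous.rpow_const ?_ fun _ => Or.inr (by norm_num)
    refine continuous_of_dominated
      (bound := fun ξ : E => 4 * ((1 + ‖ξ‖ ^ 2) ^ (-s / 2) : ℝ) ^ 2) ?_ ?_ (hw.const_mul 4) ?_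
    · intro h
      apply Measurable.aestronglyMeasurable
      have := Real.continuous_fourierChar
      fun_prop
    · intro h
      refine ae_of_all _ fun ξ => ?_
      have h1 : ‖(Real.fourierChar (inner ℝ ξ h) : ℂ) - 1‖ ≤ 2 := by
        refine (norm_sub_le _ _).trans ?_
        rw [norm_fourierChar]; norm_num
      rw [Real.rpow_two, norm_mul, Complex.norm_real, Real.norm_eq_abs, Real.norm_eq_abs,
        abs_of_nonneg (by positivity), mul_pow, sq_abs]
      gcongr
      nlinarith [norm_nonneg ((Real.fourierChar (inner ℝ ξ h) : ℂ) - 1)]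
    · refine ae_of_all _ fun ξ => ?_
      refine Continuous.rpow_const ?_ fun _ => Or.inr (by norm_num)
      have := Real.continuous_fourierChar
      fun_prop
  have h0 : sobolevModulus s (0 : E) = 0 := by simp [sobolevModulus]
  simpa [h0] using hc.tendsto 0

/-- The Sobolev embedding `H^s ⊆ C_b` for `s > d / 2`, in terms of continuous representatives. -/
theorem sobolev_embedding {s : ℝ} (hs : Module.finrank ℝ E < 2 * s) {F : E → ℂ}
    (hFc : Continuous F) (hF : MemLp F 2 volume) (v : Lp ℂ 2 (volume : Measure E))
    (hv : TemperedDistribution.besselPotential E ℂ s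
      (Lp.toTemperedDistribution (hF.toLp F)) = Lp.toTemperedDistribution v) :
    (∀ x, ‖F x‖ ≤ (∫ ξ : E, ‖(((1 + ‖ξ‖ ^ 2) ^ (-s / 2) : ℝ) : ℂ)‖ ^ (2 : ℝ)) ^ (1 / 2 : ℝ) * ‖v‖) ∧
    ∀ x y, ‖F x - F y‖ ≤ sobolevModulus s (x - y) * ‖v‖ := by
  have hw : MemLp (fun x : E => (((1 + ‖x‖ ^ 2) ^ (-s / 2) : ℝ) : ℂ)) 2 volume :=
    (memLp_two_besselWeight hs).ofReal
  set u : Lp ℂ 2 (volume : Measure E) := 𝓕 v with hu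
  have hnorm : ‖u‖ = ‖v‖ := Lp.norm_fourier_eq v
  -- Undoing the Bessel potential multiplies `𝓕 v` by the weight; a product of two `L²` functions is
  -- in `L¹`.
  have hfour : 𝓕 (Lp.toTemperedDistribution (hF.toLp F)) =
      Lp.toTemperedDistribution (hw.toLp _ • u : Lp ℂ 1 (volume : Measure E)) := by
    have hv' := (TemperedDistribution.besselPotential_neg_apply_eq_iff s
      (Lp.toTemperedDistribution v) (Lp.toTemperedDistribution (hF.toLp F))).2 hv
    rw [← hv', TemperedDistribution.fourier_besselPotential_eq_smulLeftCLM_fourier_apply,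
      Lp.fourier_toTemperedDistribution_eq, Lp.toTemperedDistribution_smul_eq (by fun_prop)]
  set g : Lp ℂ 1 (volume : Measure E) := hw.toLp _ • u with hg
  have hgi : Integrable (g : E → ℂ) := L1.integrable_coeFn g
  have hgae : ∀ᵐ ξ : E, g ξ = (((1 + ‖ξ‖ ^ 2) ^ (-s / 2) : ℝ) : ℂ) * u ξ := by
    filter_upwards [Lp.coeFn_lpSMul (r := 1) (hw.toLp _) u, hw.coeFn_toLp] with ξ h1 h2
    rw [hg, h1]
    simp [h2]
  have hrep : ∀ x, F x = ∫ ξ, (Real.fourierChar (inner ℝ ξ x) : ℂ) * g ξ := fun x => by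
    rw [eq_fourierInv_of_fourier_eq_toTemperedDistribution hFc hF g hfour x, Real.fourierInv_eq]
    simp [Circle.smul_def]
  have hint : ∀ x, Integrable fun ξ : E => (Real.fourierChar (inner ℝ ξ x) : ℂ) * g ξ := fun x => by
    have := (Real.fourierIntegral_convergent_iff (μ := volume) (f := (g : E → ℂ)) (-x)).2 hgi
    simpa [Circle.smul_def] using this
  constructor
  · intro x
    rw [← hnorm]
    refine le_trans ?_ (integral_norm_mul_le_L2 hw u)
    rw [hrep x]
    refine (norm_integral_le_integral_norm _).trans (le_of_eq (integral_congr_ae ?_))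
    filter_upwards [hgae] with ξ hξ
    rw [hξ, norm_mul, norm_mul, norm_fourierChar, one_mul]
  · intro x y
    have ha : MemLp (fun ξ : E => ((Real.fourierChar (inner ℝ ξ (x - y)) : ℂ) - 1) *
        ((1 + ‖ξ‖ ^ 2) ^ (-s / 2) : ℝ)) 2 volume := by
      refine (hw.const_mul 2).mono ?_ (ae_of_all _ fun ξ => ?_)
      · apply Measurable.aestronglyMeasurable
        have := Real.continuous_fourierChar
        fun_prop
      · rw [norm_mul, norm_mul]
        gcongr
        refine (norm_sub_le _ _).trans ?_
        rw [norm_fourierChar]; norm_num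
    rw [← hnorm]
    refine le_trans ?_ (integral_norm_mul_le_L2 ha u)
    rw [hrep x, hrep y, ← integral_sub (hint x) (hint y)]
    refine (norm_integral_le_integral_norm _).trans (le_of_eq (integral_congr_ae ?_))
    filter_upwards [hgae] with ξ hξ
    -- Factoring out the unimodular character at `y` leaves a difference depending on `x - y` only.
    have he : (Real.fourierChar (inner ℝ ξ x) : ℂ) =
        Real.fourierChar (inner ℝ ξ (x - y)) * Real.fourierChar (inner ℝ ξ y) := by
      rw [← Circle.coe_mul, ← AddChar.map_add_eq_mul, ← inner_add_right, sub_add_cancel]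
    rw [hξ, he, show ∀ a b c d : ℂ, a * b * (c * d) - b * (c * d) = b * ((a - 1) * c * d) by
      intros; ring, norm_mul, norm_mul, norm_fourierChar, one_mul]

end SobolevEmbedding

/-- A function of finite Sobolev norm on `S` is the restriction of a bounded, uniformly continuous
function, with bound and modulus of continuity proportional to the norm. -/
theorem exists_extension_of_sobolevNormOn_lt {d : ℕ} {s : ℝ} (hs : (d : ℝ) / 2 < s) :
    ∃ C : ℝ, 0 ≤ C ∧ ∀ (S : Set (Vec d)) (f : Vec d → ℝ) (M : ℝ), 0 ≤ M →
      sobolevNormOn s S f < ENNReal.ofReal M →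
      ∃ F : Vec d → ℝ, Continuous F ∧ (∀ z ∈ S, F z = f z) ∧ (∀ z, |F z| ≤ C * M) ∧
        ∀ z z', |F z - F z'| ≤ sobolevModulus s (z - z') * M := by
  have hs' : (Module.finrank ℝ (Vec d) : ℝ) < 2 * s := by
    rw [finrank_euclideanSpace_fin]; linarith
  refine ⟨(∫ ξ : Vec d, ‖(((1 + ‖ξ‖ ^ 2) ^ (-s / 2) : ℝ) : ℂ)‖ ^ (2 : ℝ)) ^ (1 / 2 : ℝ), ?_,
    fun S f M hM hlt => ?_⟩
  · positivity
  · simp only [sobolevNormOn, iInf_lt_iff] at hlt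
    obtain ⟨F, hFc, hFS, hF, v, hv, hlt⟩ := hlt
    have hvM : ‖v‖ ≤ M := by
      have := ENNReal.toReal_mono ENNReal.ofReal_ne_top hlt.le
      rwa [toReal_enorm, ENNReal.toReal_ofReal hM] at this
    obtain ⟨h1, h2⟩ := sobolev_embedding hs' hFc hF v hv
    refine ⟨fun z => (F z).re, Complex.continuous_re.comp hFc, fun z hz => by simp [hFS z hz],
      fun z => ?_, fun z z' => ?_⟩
    · refine (Complex.abs_re_le_norm _).trans ((h1 z).trans ?_)
      gcongr
    · rw [← Complex.sub_re]
      refine (Complex.abs_re_le_norm _).trans ((h2 z z').trans ?_)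
      refine mul_le_mul_of_nonneg_left hvM ?_
      unfold sobolevModulus; positivity

/-! ### Convergence in probability as a filter -/

section InProbability

variable {Ω : Type*} [MeasurableSpace Ω]

/-- The filter on `ℕ × Ω` of the events that hold with probability approaching one. Convergence in
probability to a constant is convergence along it. -/
def inProb (P : Measure Ω) : Filter (ℕ × Ω) where
  sets := {S | Tendsto (fun n => P {ω | (n, ω) ∉ S}) atTop (𝓝 0)}
  univ_sets := by simp
  sets_of_superset := by
    intro S T hS hST
    exact tendsto_of_tendsto_of_tendsto_of_le_of_le tendsto_const_nhds hS (fun _ => zero_le)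
      fun n => measure_mono fun ω hω h => hω (hST h)
  inter_sets := by
    intro S T hS hT
    have h := Tendsto.add hS hT
    rw [add_zero] at h
    refine tendsto_of_tendsto_of_tendsto_of_le_of_le tendsto_const_nhds h (fun _ => zero_le)
      fun n => ?_
    refine (measure_mono ?_).trans (measure_union_le _ _)
    intro ω hω
    simp only [Set.mem_inter_iff, not_and_or, Set.mem_ofPred_eq] at hω
    exact hω

theorem eventually_inProb {P : Measure Ω} {p : ℕ × Ω → Prop} :
    (∀ᶠ q in inProb P, p q) ↔ Tendsto (fun n => P {ω | ¬ p (n, ω)}) atTop (𝓝 0) :=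
  Iff.rfl

theorem tendstoInMeasure_const_iff {P : Measure Ω} {f : ℕ → Ω → ℝ} {c : ℝ} :
    TendstoInMeasure P f atTop (fun _ => c) ↔
      Tendsto (fun q : ℕ × Ω => f q.1 q.2) (inProb P) (𝓝 c) := by
  rw [tendstoInMeasure_iff_norm, Metric.tendsto_nhds]
  refine forall₂_congr fun r _ => ?_
  rw [eventually_inProb]
  simp [Real.dist_eq]

theorem eventually_inProb_of_ae {P : Measure Ω} {p : Ω → Prop} (h : ∀ᵐ ω ∂P, p ω) :
    ∀ᶠ q in inProb P, p q.2 := by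
  rw [eventually_inProb]
  rw [ae_iff] at h
  simp [h]

/-- Convergence in probability may be checked outside events of eventually small probability. -/
theorem tendsto_inProb_of_localized {P : Measure Ω} {α : Type*} {f : ℕ × Ω → α} {l : Filter α}
    (h : ∀ δ : ℝ≥0∞, 0 < δ → ∃ B : Set (ℕ × Ω), (∀ᶠ n in atTop, P {ω | (n, ω) ∈ B} ≤ δ) ∧
      Tendsto f (inProb P ⊓ 𝓟 Bᶜ) l) : Tendsto f (inProb P) l := by
  intro U hU
  change Tendsto _ _ _
  rw [ENNReal.tendsto_nhds_zero]
  intro δ hδ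
  obtain ⟨B, hB, hf⟩ := h (δ / 2) (ENNReal.half_pos hδ.ne')
  have hfU := mem_inf_principal.1 (hf hU)
  have hfU' := (ENNReal.tendsto_nhds_zero.1 hfU) (δ / 2) (ENNReal.half_pos hδ.ne')
  filter_upwards [hB, hfU'] with n h1 h2
  rw [← ENNReal.add_halves δ]
  refine le_trans ?_ (add_le_add h1 h2)
  refine (measure_mono ?_).trans (measure_union_le _ _)
  intro ω hω
  by_cases hb : (n, ω) ∈ B
  · exact Or.inl hb
  · exact Or.inr fun hc => hω (hc hb)

end InProbability

/-! ### Empirical `L⁴` norms -/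

section Averages

/-- The mean of the first `n` terms. -/
noncomputable def avg (n : ℕ) (f : ℕ → ℝ) : ℝ := (n : ℝ)⁻¹ * ∑ i ∈ Finset.range n, f i

theorem avg_nonneg {n : ℕ} {f : ℕ → ℝ} (hf : ∀ i, 0 ≤ f i) : 0 ≤ avg n f :=
  mul_nonneg (by positivity) (Finset.sum_nonneg fun i _ => hf i)

theorem avg_mono {n : ℕ} {f g : ℕ → ℝ} (h : ∀ i, f i ≤ g i) : avg n f ≤ avg n g :=
  mul_le_mul_of_nonneg_left (Finset.sum_le_sum fun i _ => h i) (by positivity)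

theorem avg_add (n : ℕ) (f g : ℕ → ℝ) : avg n (fun i => f i + g i) = avg n f + avg n g := by
  simp [avg, Finset.sum_add_distrib, mul_add]

theorem avg_const_mul (n : ℕ) (c : ℝ) (f : ℕ → ℝ) : avg n (fun i => c * f i) = c * avg n f := by
  simp only [avg, ← Finset.mul_sum]; ring

theorem avg_const_le (n : ℕ) {c : ℝ} (hc : 0 ≤ c) : avg n (fun _ => c) ≤ c := by
  simp only [avg, Finset.sum_const, Finset.card_range, nsmul_eq_mul, ← mul_assoc]
  rcases eq_or_ne (n : ℝ) 0 with h | h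
  · simpa [h] using hc
  · rw [inv_mul_cancel₀ h, one_mul]

theorem avg_mul_sq_le (n : ℕ) (f g : ℕ → ℝ) :
    avg n (fun i => f i * g i) ^ 2 ≤ avg n (fun i => f i ^ 2) * avg n (fun i => g i ^ 2) := by
  have h := Finset.sum_mul_sq_le_sq_mul_sq (Finset.range n) f g
  simp only [avg, mul_pow]
  calc _ ≤ ((n : ℝ)⁻¹) ^ 2 * ((∑ i ∈ Finset.range n, f i ^ 2) * ∑ i ∈ Finset.range n, g i ^ 2) := by
        gcongr
    _ = _ := by ring

/-- Hölder's inequality for four factors. -/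
theorem avg_mul_four_le (n : ℕ) (a b c d : ℕ → ℝ) :
    avg n (fun i => a i * b i * (c i * d i)) ^ 4 ≤
      avg n (fun i => a i ^ 4) * avg n (fun i => b i ^ 4) *
        (avg n (fun i => c i ^ 4) * avg n (fun i => d i ^ 4)) := by
  have key : ∀ f g : ℕ → ℝ, avg n (fun i => (f i * g i) ^ 2) ^ 2 ≤
      avg n (fun i => f i ^ 4) * avg n (fun i => g i ^ 4) := fun f g => by
    have h := avg_mul_sq_le n (fun i => f i ^ 2) (fun i => g i ^ 2)
    simpa only [mul_pow, ← pow_mul] using h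
  calc _ = (avg n (fun i => a i * b i * (c i * d i)) ^ 2) ^ 2 := by ring
    _ ≤ (avg n (fun i => (a i * b i) ^ 2) * avg n (fun i => (c i * d i) ^ 2)) ^ 2 := by
        gcongr; exact avg_mul_sq_le n _ _
    _ = avg n (fun i => (a i * b i) ^ 2) ^ 2 * avg n (fun i => (c i * d i) ^ 2) ^ 2 := by ring
    _ ≤ _ := mul_le_mul (key a b) (key c d) (by positivity)
        (mul_nonneg (avg_nonneg fun _ => by positivity) (avg_nonneg fun _ => by positivity))

variable {I : Type*} {n : I → ℕ} {l : Filter I}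

/-- The empirical `L⁴` norms tend to zero. -/
def L4Null (n : I → ℕ) (l : Filter I) (a : I → ℕ → ℝ) : Prop :=
  Tendsto (fun q => avg (n q) (fun i => a q i ^ 4)) l (𝓝 0)

/-- The empirical `L⁴` norms are eventually bounded. -/
def L4Bdd (n : I → ℕ) (l : Filter I) (a : I → ℕ → ℝ) : Prop :=
  ∃ C, ∀ᶠ q in l, avg (n q) (fun i => a q i ^ 4) ≤ C

theorem avg_add_pow_four_le (n : ℕ) (a b : ℕ → ℝ) : avg n (fun i => (a i + b i) ^ 4) ≤
    8 * (avg n (fun i => a i ^ 4) + avg n (fun i => b i ^ 4)) := by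
  rw [← avg_add, ← avg_const_mul]
  refine avg_mono fun i => ?_
  have h1 : (a i + b i) ^ 2 ≤ 2 * (a i ^ 2 + b i ^ 2) := by nlinarith [sq_nonneg (a i - b i)]
  have h2 : (a i ^ 2 + b i ^ 2) ^ 2 ≤ 2 * (a i ^ 4 + b i ^ 4) := by
    nlinarith [sq_nonneg (a i ^ 2 - b i ^ 2)]
  calc (a i + b i) ^ 4 = ((a i + b i) ^ 2) ^ 2 := by ring
    _ ≤ (2 * (a i ^ 2 + b i ^ 2)) ^ 2 := by gcongr
    _ ≤ _ := by nlinarith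

theorem L4Null.add {a b : I → ℕ → ℝ} (ha : L4Null n l a) (hb : L4Null n l b) :
    L4Null n l fun q i => a q i + b q i := by
  have h := (Tendsto.add ha hb).const_mul 8
  rw [add_zero, mul_zero] at h
  exact squeeze_zero (fun q => avg_nonneg fun _ => by positivity)
    (fun q => avg_add_pow_four_le _ _ _) h

theorem L4Null.zero : L4Null n l fun _ _ => 0 := by
  simpa [L4Null, avg] using tendsto_const_nhds

theorem L4Null.sum {ι : Type*} (s : Finset ι) {a : ι → I → ℕ → ℝ}
    (ha : ∀ j ∈ s, L4Null n l (a j)) : L4Null n l fun q i => ∑ j ∈ s, a j q i := by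
  classical
  induction s using Finset.induction_on with
  | empty => simpa using L4Null.zero
  | insert j s hj ih =>
    simp only [Finset.sum_insert hj]
    exact (ha j (by simp)).add (ih fun k hk => ha k (by simp [hk]))

theorem L4Bdd.add {a b : I → ℕ → ℝ} (ha : L4Bdd n l a) (hb : L4Bdd n l b) :
    L4Bdd n l fun q i => a q i + b q i := by
  obtain ⟨A, hA⟩ := ha
  obtain ⟨B, hB⟩ := hb
  refine ⟨8 * (A + B), ?_⟩
  filter_upwards [hA, hB] with q h1 h2
  exact (avg_add_pow_four_le _ _ _).trans (by gcongr)

theorem L4Null.bdd {a : I → ℕ → ℝ} (ha : L4Null n l a) : L4Bdd n l a :=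
  ⟨1, (ha.eventually (gt_mem_nhds one_pos)).mono fun _ h => h.le⟩

theorem L4Bdd.of_sub {a b : I → ℕ → ℝ} (hab : L4Null n l fun q i => a q i - b q i)
    (hb : L4Bdd n l b) : L4Bdd n l a := by
  simpa using hab.bdd.add hb

/-- A vanishing multiple of a bounded sequence is null. -/
theorem L4Bdd.null_mul {a : I → ℕ → ℝ} (ha : L4Bdd n l a) {c : I → ℝ} (hc : Tendsto c l (𝓝 0)) :
    L4Null n l fun q i => c q * a q i := by
  obtain ⟨A, hA⟩ := ha
  have h := (hc.pow 4).mul_const A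
  rw [show (0 : ℝ) ^ 4 * A = 0 by ring] at h
  refine squeeze_zero' (Eventually.of_forall fun q => avg_nonneg fun _ => by positivity) ?_ h
  filter_upwards [hA] with q hq
  simp only [mul_pow]
  rw [avg_const_mul]
  gcongr

/-- By Hölder, the fourth power of the average is at most the product of four empirical fourth
moments, one of which vanishes. -/
theorem tendsto_avg_mul_of_null {a b c d : I → ℕ → ℝ} (ha : L4Null n l a) (hb : L4Bdd n l b)
    (hc : L4Bdd n l c) (hd : L4Bdd n l d) :
    Tendsto (fun q => avg (n q) fun i => a q i * b q i * (c q i * d q i)) l (𝓝 0) := by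
  obtain ⟨B, hB⟩ := hb
  obtain ⟨C, hC⟩ := hc
  obtain ⟨D, hD⟩ := hd
  have h4 : Tendsto (fun q => (avg (n q) fun i => a q i * b q i * (c q i * d q i)) ^ 4) l
      (𝓝 0) := by
    have h := ha.mul_const (B * (C * D))
    rw [zero_mul] at h
    refine squeeze_zero' (Eventually.of_forall fun q => by positivity) ?_ h
    filter_upwards [hB, hC, hD] with q h1 h2 h3
    have hnn : ∀ f : ℕ → ℝ, 0 ≤ avg (n q) (fun i => f i ^ 4) := fun f =>
      avg_nonneg fun _ => by positivity
    refine (avg_mul_four_le _ _ _ _ _).trans ?_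
    rw [mul_assoc]
    gcongr
    · exact hnn _
    · exact mul_nonneg (hnn _) (hnn _)
    · exact (hnn _).trans h1
    · exact hnn _
    · exact (hnn _).trans h2
  rw [Metric.tendsto_nhds] at h4 ⊢
  intro r hr
  filter_upwards [h4 (r ^ 4) (by positivity)] with q hq
  rw [Real.dist_eq, sub_zero, abs_pow] at hq
  rw [Real.dist_eq, sub_zero]
  exact lt_of_pow_lt_pow_left₀ 4 hr.le hq

/-- Averages of four-fold products are continuous in the empirical `L⁴` norm. -/
theorem tendsto_avg_mul_four {a b c d a' b' c' d' : I → ℕ → ℝ} {L : ℝ}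
    (ha : L4Null n l fun q i => a q i - a' q i) (hb : L4Null n l fun q i => b q i - b' q i)
    (hc : L4Null n l fun q i => c q i - c' q i) (hd : L4Null n l fun q i => d q i - d' q i)
    (ha' : L4Bdd n l a') (hb' : L4Bdd n l b') (hc' : L4Bdd n l c') (hd' : L4Bdd n l d')
    (h : Tendsto (fun q => avg (n q) fun i => a' q i * b' q i * (c' q i * d' q i)) l (𝓝 L)) :
    Tendsto (fun q => avg (n q) fun i => a q i * b q i * (c q i * d q i)) l (𝓝 L) := by
  have hB := L4Bdd.of_sub hb hb'
  have hC := L4Bdd.of_sub hc hc'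
  have hD := L4Bdd.of_sub hd hd'
  -- Telescoping: primed factors replace unprimed ones one at a time, each replacement contributing
  -- one null difference.
  have h1 := tendsto_avg_mul_of_null ha hB hC hD
  have h2 := tendsto_avg_mul_of_null hb ha' hC hD
  have h3 := tendsto_avg_mul_of_null hc hD ha' hb'
  have h4 := tendsto_avg_mul_of_null hd hc' ha' hb'
  have hsum := (((h1.add h2).add h3).add h4).add h
  simp only [add_zero, zero_add] at hsum
  refine hsum.congr fun q => ?_
  simp only [← avg_add]
  congr 1
  ext i
  ring

end Averages

/-! ### Laws of large numbers -/

section LawOfLargeNumbers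

variable {Ω : Type*} [MeasurableSpace Ω] {P : Measure Ω} [IsProbabilityMeasure P]
  {D : Type*} [MeasurableSpace D] {U : ℕ → Ω → D}

/-- The law of large numbers along the filter of convergence in probability. -/
theorem tendsto_avg_inProb (hindep : iIndepFun U P) (hident : ∀ i, IdentDistrib (U i) (U 0) P P)
    {h : D → ℝ} (hh : Measurable h) (hint : Integrable (fun ω => h (U 0 ω)) P) :
    Tendsto (fun q : ℕ × Ω => avg q.1 fun i => h (U i q.2)) (inProb P)
      (𝓝 (∫ ω, h (U 0 ω) ∂P)) := by
  have hid : ∀ i, IdentDistrib (fun ω => h (U i ω)) (fun ω => h (U 0 ω)) P P :=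
    fun i => (hident i).comp hh
  have hae := strong_law_ae_real (fun i ω => h (U i ω)) hint
    (fun i j hij => (hindep.indepFun hij).comp hh hh) hid
  rw [← tendstoInMeasure_const_iff (f := fun n ω => avg n fun i => h (U i ω))]
  refine tendstoInMeasure_of_tendsto_ae (fun n => ?_) ?_
  · unfold avg
    refine AEStronglyMeasurable.const_mul ?_ _
    exact Finset.aestronglyMeasurable_fun_sum _ fun i _ =>
      (hid i).aemeasurable_fst.aestronglyMeasurable
  · filter_upwards [hae] with ω hω
    refine hω.congr fun n => ?_
    rw [avg, div_eq_inv_mul]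

theorem l4Bdd_of_iid (hindep : iIndepFun U P) (hident : ∀ i, IdentDistrib (U i) (U 0) P P)
    {h : D → ℝ} (hh : Measurable h) (hL4 : MemLp (fun ω => h (U 0 ω)) 4 P) {l : Filter (ℕ × Ω)}
    (hl : l ≤ inProb P) : L4Bdd Prod.fst l fun q i => h (U i q.2) := by
  have hint : Integrable (fun ω => h (U 0 ω) ^ 4) P := by
    have := hL4.integrable_norm_pow (p := 4) (by norm_num)
    refine this.congr (ae_of_all _ fun ω => ?_)
    simp only [Real.norm_eq_abs]
    exact (show Even 4 by decide).pow_abs _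
  have ht := (tendsto_avg_inProb hindep hident (h := fun u => h u ^ 4) (by fun_prop) hint).mono_left
    hl
  exact ⟨_, (ht.eventually (gt_mem_nhds (lt_add_one _))).mono fun _ h => h.le⟩

end LawOfLargeNumbers

/-! ### From `L²` of the law to empirical `L⁴`, uniformly over a class -/

section EquicontinuousClass

variable {E : Type*} [NormedAddCommGroup E] [MeasurableSpace E] [BorelSpace E]

/-- A bounded equicontinuous function is controlled by its `L²` norm off a set of small measure. -/
theorem exists_sq_le_integral_add (ν : Measure E) [IsFiniteMeasure ν] [SecondCountableTopology E]
    [ν.InnerRegularCompactLTTop] {m : E → ℝ} (hm : Tendsto m (𝓝 0) (𝓝 0)) (K : ℝ) {η : ℝ}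
    (hη : 0 < η) :
    ∃ B : Set E, MeasurableSet B ∧ ν.real B < η ∧ ∃ c : ℝ, 0 ≤ c ∧ ∀ G : E → ℝ, Continuous G →
      (∀ z, |G z| ≤ K) → (∀ z z', |G z - G z'| ≤ m (z - z')) →
      ∀ z, G z ^ 2 ≤ c * ∫ w, G w ^ 2 ∂ν + 2 * η ^ 2 + K ^ 2 * B.indicator 1 z := by
  -- `C` is a compact part of the support missing mass less than `η`; its complement is the
  -- exceptional set.
  obtain ⟨C, hCS, hC, hCc, hνC⟩ := (Measure.isClosed_support (μ := ν)).measurableSet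
    |>.exists_isCompact_isClosed_sdiff_lt (μ := ν) (measure_ne_top _ _)
      (ENNReal.ofReal_pos.2 hη).ne'
  have hνB : ν Cᶜ < ENNReal.ofReal η := by
    refine lt_of_le_of_lt (measure_mono_ae ?_) hνC
    filter_upwards [Measure.support_mem_ae (μ := ν)] with z hz hzC
    exact ⟨hz, hzC⟩
  obtain ⟨r, hr, hmr⟩ := Metric.eventually_nhds_iff.1 (hm.eventually (gt_mem_nhds hη))
  obtain ⟨t, htC, htc⟩ := hC.elim_nhds_subcover (fun x => Metric.ball x (r / 2))
    (fun x _ => Metric.ball_mem_nhds x (by positivity))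
  -- The centres lie in the support, so these finitely many masses are positive and the constant `c`
  -- built from them does not depend on `G`.
  have hpos : ∀ x ∈ t, 0 < ν.real (Metric.ball x (r / 2)) := fun x hx =>
    ENNReal.toReal_pos ((Measure.mem_support_iff_forall _).1 (hCS (htC x hx)) _
      (Metric.ball_mem_nhds _ (by positivity))).ne' (measure_ne_top _ _)
  refine ⟨Cᶜ, hCc.measurableSet.compl, ?_,
    ∑ x ∈ t, 2 / ν.real (Metric.ball x (r / 2)), ?_, fun G hGc hGK hGm z => ?_⟩
  · exact ENNReal.toReal_lt_of_lt_ofReal hνB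
  · exact Finset.sum_nonneg fun x hx => (div_pos two_pos (hpos x hx)).le
  have hI : 0 ≤ ∫ w, G w ^ 2 ∂ν := integral_nonneg fun _ => by positivity
  have hterm : ∀ x ∈ t, 0 ≤ 2 / ν.real (Metric.ball x (r / 2)) := fun x hx =>
    (div_pos two_pos (hpos x hx)).le
  by_cases hz : z ∈ C
  · obtain ⟨x, hxt, hzx⟩ := Set.mem_iUnion₂.1 (htc hz)
    set A := Metric.ball x (r / 2) with hA
    have hGi : Integrable (fun w => G w ^ 2) ν := by
      refine Integrable.of_bound (by fun_prop) (K ^ 2) (ae_of_all _ fun w => ?_)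
      rw [norm_pow, Real.norm_eq_abs]
      gcongr
      exact hGK w
    -- On a ball of radius `r / 2` the function varies by at most `η`; integrating over `w` in the
    -- ball bounds `G z ^ 2` by a local `L²` mean.
    have hloc : ∀ w ∈ A, G z ^ 2 ≤ 2 * G w ^ 2 + 2 * η ^ 2 := fun w hw => by
      have hd : dist (z - w) 0 < r := by
        rw [dist_zero_right, ← dist_eq_norm]
        have h1 : dist z x < r / 2 := hzx
        have h2 : dist w x < r / 2 := hw
        linarith [dist_triangle_right z w x]
      have h := ((hGm z w).trans_lt (hmr hd)).le
      have h2 : (G z - G w) ^ 2 ≤ η ^ 2 := by rw [← sq_abs]; gcongr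
      nlinarith [sq_nonneg (G z - 2 * G w)]
    have hint : ∫ _ in A, G z ^ 2 ∂ν ≤ ∫ w in A, (2 * G w ^ 2 + 2 * η ^ 2) ∂ν :=
      setIntegral_mono_on (by simp)
        (((hGi.const_mul 2).add (integrable_const _)).integrableOn) Metric.isOpen_ball.measurableSet
        hloc
    rw [setIntegral_const, integral_add (hGi.const_mul 2).integrableOn (integrable_const _),
      setIntegral_const, integral_const_mul, smul_eq_mul, smul_eq_mul] at hint
    have hset : ∫ w in A, G w ^ 2 ∂ν ≤ ∫ w, G w ^ 2 ∂ν :=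
      setIntegral_le_integral hGi (ae_of_all _ fun _ => by positivity)
    have hone : 2 / ν.real A ≤ ∑ x ∈ t, 2 / ν.real (Metric.ball x (r / 2)) :=
      Finset.single_le_sum (f := fun x => 2 / ν.real (Metric.ball x (r / 2))) hterm hxt
    have hdiv : G z ^ 2 ≤ 2 / ν.real A * ∫ w, G w ^ 2 ∂ν + 2 * η ^ 2 := by
      rw [div_mul_eq_mul_div, ← sub_le_iff_le_add, le_div_iff₀ (hpos x hxt)]
      nlinarith
    have hind : 0 ≤ K ^ 2 * Cᶜ.indicator (1 : E → ℝ) z :=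
      mul_nonneg (sq_nonneg _) (Set.indicator_nonneg (fun _ _ => zero_le_one) _)
    nlinarith [mul_le_mul_of_nonneg_right hone hI]
  · have h1 : Cᶜ.indicator (1 : E → ℝ) z = 1 := by simp [hz]
    have h2 : G z ^ 2 ≤ K ^ 2 := by rw [← sq_abs]; gcongr; exact hGK z
    rw [h1]
    nlinarith [mul_nonneg (Finset.sum_nonneg hterm) hI, sq_nonneg η]

/-- For random functions in a bounded equicontinuous class, convergence to zero in `L²` of the
common law implies convergence to zero of the empirical `L⁴` norm. The functions may depend on the
sample. -/
theorem l4Null_of_equicontinuous [SecondCountableTopology E] {Ω : Type*} [MeasurableSpace Ω]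
    {P : Measure Ω} [IsProbabilityMeasure P] {Z : ℕ → Ω → E} (hindep : iIndepFun Z P)
    (hident : ∀ i, IdentDistrib (Z i) (Z 0) P P) (hZ : Measurable (Z 0))
    [(P.map (Z 0)).InnerRegularCompactLTTop] {l : Filter (ℕ × Ω)} (hl : l ≤ inProb P)
    {m : E → ℝ} (hm : Tendsto m (𝓝 0) (𝓝 0)) {K : ℝ} {G : ℕ × Ω → E → ℝ}
    (hG : ∀ᶠ q in l, Continuous (G q) ∧ (∀ z, |G q z| ≤ K) ∧
      ∀ z z', |G q z - G q z'| ≤ m (z - z'))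
    (hL2 : Tendsto (fun q => ∫ z, G q z ^ 2 ∂(P.map (Z 0))) l (𝓝 0)) :
    L4Null Prod.fst l fun q i => G q (Z i q.2) := by
  have : IsProbabilityMeasure (P.map (Z 0)) := Measure.isProbabilityMeasure_map hZ.aemeasurable
  rw [L4Null, Metric.tendsto_nhds]
  intro r hr
  -- This is the limiting bound on the fourth moment once the `L²` norm has vanished; `η` is chosen
  -- to make it less than `r`.
  have hlim : Tendsto (fun η : ℝ => K ^ 2 * (0 + 2 * η ^ 2 + K ^ 2 * η)) (𝓝[>] 0) (𝓝 0) := by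
    have : Continuous fun η : ℝ => K ^ 2 * (0 + 2 * η ^ 2 + K ^ 2 * η) := by fun_prop
    simpa using (this.tendsto 0).mono_left nhdsWithin_le_nhds
  obtain ⟨η, hηr, hη⟩ :=
    ((hlim.eventually (gt_mem_nhds hr)).and self_mem_nhdsWithin).exists
  obtain ⟨B, hB, hνB, c, hc0, hc⟩ := exists_sq_le_integral_add (P.map (Z 0)) hm K hη
  have hBlim : Tendsto (fun q : ℕ × Ω => avg q.1 fun i => B.indicator (1 : E → ℝ) (Z i q.2)) l
      (𝓝 ((P.map (Z 0)).real B)) := by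
    have hmeas : Measurable (B.indicator (1 : E → ℝ)) := measurable_one.indicator hB
    have h := (tendsto_avg_inProb hindep hident hmeas ?_).mono_left hl
    · rwa [← integral_map (φ := Z 0) hZ.aemeasurable hmeas.aestronglyMeasurable,
        integral_indicator_one hB] at h
    · exact Integrable.of_bound (hmeas.comp hZ).aestronglyMeasurable 1 (ae_of_all _ fun ω => by
        by_cases h : Z 0 ω ∈ B <;> simp [h])
  have hupper := (((hL2.const_mul c).add_const (2 * η ^ 2)).add (hBlim.const_mul (K ^ 2))).const_mul
    (K ^ 2)
  have hlt : K ^ 2 * (c * 0 + 2 * η ^ 2 + K ^ 2 * (P.map (Z 0)).real B) < r := by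
    refine lt_of_le_of_lt ?_ hηr
    rw [mul_zero]
    gcongr
  filter_upwards [hupper.eventually (gt_mem_nhds hlt), hG] with q hq hGq
  obtain ⟨hGc, hGK, hGm⟩ := hGq
  rw [Real.dist_eq, sub_zero, abs_of_nonneg (avg_nonneg fun _ => by positivity)]
  refine lt_of_le_of_lt ?_ hq
  have hI : 0 ≤ c * ∫ z, G q z ^ 2 ∂(P.map (Z 0)) + 2 * η ^ 2 :=
    add_nonneg (mul_nonneg hc0 (integral_nonneg fun _ => sq_nonneg _)) (by positivity)
  calc avg q.1 (fun i => G q (Z i q.2) ^ 4)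
      ≤ avg q.1 (fun i => K ^ 2 * (c * ∫ z, G q z ^ 2 ∂(P.map (Z 0)) + 2 * η ^ 2
          + K ^ 2 * B.indicator 1 (Z i q.2))) := by
        refine avg_mono fun i => ?_
        have h1 := hc (G q) hGc hGK hGm (Z i q.2)
        have h2 : G q (Z i q.2) ^ 2 ≤ K ^ 2 := by rw [← sq_abs]; gcongr; exact hGK _
        calc G q (Z i q.2) ^ 4 = G q (Z i q.2) ^ 2 * G q (Z i q.2) ^ 2 := by ring
          _ ≤ _ := mul_le_mul h2 h1 (sq_nonneg _) (sq_nonneg _)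
    _ ≤ _ := by
        rw [avg_const_mul, avg_add, avg_const_mul]
        gcongr
        exact avg_const_le _ hI

end EquicontinuousClass

/-! ### Consistency given an `L⁴`-consistent first stage -/

section Consistency

theorem MeasureTheory.MemLp.mul_four {Ω : Type*} [MeasurableSpace Ω] {P : Measure Ω} {f g : Ω → ℝ} (hf : MemLp f 4 P) (hg : MemLp g 4 P) :
    MemLp (fun ω => f ω * g ω) 2 P := by
  have : ENNReal.HolderTriple 4 4 2 := ⟨by
    rw [← two_mul, show (4 : ℝ≥0∞) = 2 * 2 by norm_num,
      ENNReal.mul_inv (by simp) (by simp), ← mul_assoc,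
      ENNReal.mul_inv_cancel (by simp) (by simp), one_mul]⟩
  exact hg.mul' hf

theorem integrable_mul_four {Ω : Type*} [MeasurableSpace Ω] {P : Measure Ω} {f g h k : Ω → ℝ}
    (hf : MemLp f 4 P) (hg : MemLp g 4 P)
    (hh : MemLp h 4 P) (hk : MemLp k 4 P) :
    Integrable (fun ω => f ω * g ω * (h ω * k ω)) P :=
  (hf.mul_four hg).integrable_mul (hh.mul_four hk)

variable {Ω : Type*} [MeasurableSpace Ω] {P : Measure Ω} [IsProbabilityMeasure P]

/-- Averages of products of four sequences that are close, in empirical `L⁴` norm, to functions of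
an i.i.d. sequence converge to the population mean. -/
theorem tendsto_avg_mul_four_iid {D : Type*} [MeasurableSpace D] {U : ℕ → Ω → D}
    (hindep : iIndepFun U P) (hident : ∀ i, IdentDistrib (U i) (U 0) P P)
    {l : Filter (ℕ × Ω)} (hl : l ≤ inProb P) {f₁ f₂ f₃ f₄ : D → ℝ}
    (m₁ : Measurable f₁) (m₂ : Measurable f₂) (m₃ : Measurable f₃) (m₄ : Measurable f₄)
    (h₁ : MemLp (fun ω => f₁ (U 0 ω)) 4 P) (h₂ : MemLp (fun ω => f₂ (U 0 ω)) 4 P)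
    (h₃ : MemLp (fun ω => f₃ (U 0 ω)) 4 P) (h₄ : MemLp (fun ω => f₄ (U 0 ω)) 4 P)
    {a b c d : ℕ × Ω → ℕ → ℝ}
    (ha : L4Null Prod.fst l fun q i => a q i - f₁ (U i q.2))
    (hb : L4Null Prod.fst l fun q i => b q i - f₂ (U i q.2))
    (hc : L4Null Prod.fst l fun q i => c q i - f₃ (U i q.2))
    (hd : L4Null Prod.fst l fun q i => d q i - f₄ (U i q.2)) :
    Tendsto (fun q => avg q.1 fun i => a q i * b q i * (c q i * d q i)) l
      (𝓝 (∫ ω, f₁ (U 0 ω) * f₂ (U 0 ω) * (f₃ (U 0 ω) * f₄ (U 0 ω)) ∂P)) :=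
  tendsto_avg_mul_four ha hb hc hd (l4Bdd_of_iid hindep hident m₁ h₁ hl)
    (l4Bdd_of_iid hindep hident m₂ h₂ hl) (l4Bdd_of_iid hindep hident m₃ h₃ hl)
    (l4Bdd_of_iid hindep hident m₄ h₄ hl)
    ((tendsto_avg_inProb hindep hident (h := fun u => f₁ u * f₂ u * (f₃ u * f₄ u)) (by fun_prop)
      (integrable_mul_four h₁ h₂ h₃ h₄)).mono_left hl)

/-- Tower property, with the `Z`-measurable factor pulled out of the conditional expectation. -/
theorem integral_comp_mul_of_condExp {E : Type*} [MeasurableSpace E] {Z : Ω → E}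
    (hZ : Measurable Z) {f : Ω → ℝ} {g h : E → ℝ} (hg : Measurable g) (hf : Integrable f P)
    (hgf : Integrable (fun ω => g (Z ω) * f ω) P)
    (hcond : P[f | MeasurableSpace.comap Z inferInstance] =ᵐ[P] fun ω => h (Z ω)) :
    ∫ ω, g (Z ω) * f ω ∂P = ∫ ω, g (Z ω) * h (Z ω) ∂P := by
  have hm : MeasurableSpace.comap Z inferInstance ≤ _ := hZ.comap_le
  rw [← integral_condExp hm (f := fun ω => g (Z ω) * f ω)]
  refine integral_congr_ae ?_
  have hgm : StronglyMeasurable[MeasurableSpace.comap Z inferInstance] fun ω => g (Z ω) :=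
    (hg.comp (comap_measurable Z)).stronglyMeasurable
  filter_upwards [condExp_mul_of_stronglyMeasurable_left hgm hgf hf, hcond] with ω h1 h2
  rw [show (fun ω => g (Z ω) * f ω) = (fun ω => g (Z ω)) * f from rfl, h1, Pi.mul_apply, h2]

theorem Matrix.det_ne_zero_of_rank_eq_card {ι : Type*} [Fintype ι] [DecidableEq ι]
    {A : Matrix ι ι ℝ} (h : A.rank = Fintype.card ι) : A.det ≠ 0 := by
  have hs : Function.Surjective A.mulVec := by
    have : LinearMap.range A.mulVecLin = ⊤ :=
      Submodule.eq_top_of_finrank_eq (by rw [← Matrix.rank, h, Module.finrank_fintype_fun_eq_card])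
    exact LinearMap.range_eq_top.1 this
  have hu := (Matrix.mulVec_surjective_iff_isUnit).1 hs
  exact ((Matrix.isUnit_iff_isUnit_det A).1 hu).ne_zero

theorem Filter.Tendsto.matrix_inv {ι I : Type*} [Fintype ι] [DecidableEq ι] {l : Filter I}
    {A : I → Matrix ι ι ℝ} {B : Matrix ι ι ℝ} (hA : Tendsto A l (𝓝 B)) (hB : B.det ≠ 0) :
    Tendsto (fun q => (A q)⁻¹) l (𝓝 B⁻¹) := by
  simp only [Matrix.inv_def, Ring.inverse_eq_inv']
  have h1 : Tendsto (fun q => (A q).det) l (𝓝 B.det) :=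
    (continuous_id.matrix_det.tendsto B).comp hA
  have h2 : Tendsto (fun q => (A q).adjugate) l (𝓝 B.adjugate) :=
    (continuous_id.matrix_adjugate.tendsto B).comp hA
  exact (h1.inv₀ hB).smul h2

variable {dz dx : ℕ}

theorem regResidual_eq (θ : Coef dz dx → ℝ) (y : ℝ) (x : Vec dx) (z : Vec dz) :
    regResidual θ y x z = y - ∑ a, stack z x a * θ a := by
  simp only [regResidual, stack, Fintype.sum_sum_type, Sum.elim_inl, Sum.elim_inr,
    Finset.univ_unique, Finset.sum_singleton, PUnit.default_eq_unit]
  ring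

theorem measurable_stack {D : Type*} [MeasurableSpace D] {z : D → Vec dz} {x : D → Vec dx}
    (hz : Measurable z) (hx : Measurable x) (a : Coef dz dx) :
    Measurable fun u => stack (z u) (x u) a := by
  rcases a with _ | j | k <;> simp only [stack, Sum.elim_inl, Sum.elim_inr] <;> fun_prop

theorem memLp_stack {p : ℝ≥0∞} {z : Ω → Vec dz} {x : Ω → Vec dx} (hz : MemLp z p P)
    (hx : MemLp x p P) (a : Coef dz dx) : MemLp (fun ω => stack (z ω) (x ω) a) p P := by
  rcases a with _ | j | k <;> simp only [stack, Sum.elim_inl, Sum.elim_inr]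
  · exact memLp_const 1
  · refine hz.of_le ?_ (ae_of_all _ fun ω => PiLp.norm_apply_le (z ω) j)
    exact (EuclideanSpace.proj (𝕜 := ℝ) j).continuous.comp_aestronglyMeasurable hz.1
  · refine hx.of_le ?_ (ae_of_all _ fun ω => PiLp.norm_apply_le (x ω) k)
    exact (EuclideanSpace.proj (𝕜 := ℝ) k).continuous.comp_aestronglyMeasurable hx.1

/-- The padding `1 * 1` gives the four-factor form required by `tendsto_avg_mul_four_iid`. -/
theorem sigmaHat_apply (n : ℕ) (z : ℕ → Vec dz) (p : Vec dz → Vec dx) (a b : Coef dz dx) :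
    sigmaHat n z p a b =
      avg n fun i => 1 * 1 * (stack (z i) (p (z i)) a * stack (z i) (p (z i)) b) := by
  simp [sigmaHat, avg, Matrix.sum_apply, Matrix.vecMulVec_apply]

theorem omegaHat_apply (n : ℕ) (y : ℕ → ℝ) (x : ℕ → Vec dx) (z : ℕ → Vec dz)
    (p : Vec dz → Vec dx) (a b : Coef dz dx) :
    omegaHat n y x z p a b = avg n fun i => epsHat n y x z p i * epsHat n y x z p i *
      (stack (z i) (p (z i)) a * stack (z i) (p (z i)) b) := by
  simp [omegaHat, avg, Matrix.sum_apply, Matrix.vecMulVec_apply, sq]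

/-- Consistency of the variance estimators, along any filter finer than that of convergence in
probability, when the first stage is consistent in the empirical `L⁴` norm. -/
theorem tendsto_vHat_of_l4Null
    (Y : ℕ → Ω → ℝ) (X : ℕ → Ω → Vec dx) (Z : ℕ → Ω → Vec dz)
    (hZ : Measurable (Z 0))
    (hindep : iIndepFun (fun i ω => (Y i ω, X i ω, Z i ω)) P)
    (hident : ∀ i, IdentDistrib (fun ω => (Y i ω, X i ω, Z i ω))
      (fun ω => (Y 0 ω, X 0 ω, Z 0 ω)) P P)
    (θ₀ : Coef dz dx → ℝ) (ε : ℕ → Ω → ℝ)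
    (hε : ∀ i ω, ε i ω = regResidual θ₀ (Y i ω) (X i ω) (Z i ω))
    (hexog : P[ε 0 | MeasurableSpace.comap (Z 0) inferInstance] =ᵐ[P] 0)
    (π₀ : Vec dz → Vec dx) (hπ₀m : Measurable π₀) (hπ₀4 : MemLp (fun ω => π₀ (Z 0 ω)) 4 P)
    (hπ₀ : P[X 0 | MeasurableSpace.comap (Z 0) inferInstance] =ᵐ[P] fun ω => π₀ (Z 0 ω))
    (hrank : (popSigma P (Z 0) π₀).rank = Fintype.card (Coef dz dx))
    (hε4 : MemLp (ε 0) 4 P) (hX4 : MemLp (X 0) 4 P) (hZ4 : MemLp (Z 0) 4 P)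
    (πhat : ℕ → Ω → Vec dz → Vec dx) {l : Filter (ℕ × Ω)} (hl : l ≤ inProb P)
    (hπhat : ∀ k, L4Null Prod.fst l fun q i =>
      πhat q.1 q.2 (Z i q.2) k - π₀ (Z i q.2) k) :
    Tendsto (fun q : ℕ × Ω => vHat q.1 (fun i => Y i q.2) (fun i => X i q.2) (fun i => Z i q.2)
      (πhat q.1 q.2)) l (𝓝 (popV P (ε 0) (Z 0) π₀)) ∧
    ∀ σsq : ℝ,
      P[fun ω => ε 0 ω ^ 2 | MeasurableSpace.comap (Z 0) inferInstance] =ᵐ[P] (fun _ => σsq) →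
      Tendsto (fun q : ℕ × Ω => vHatHom q.1 (fun i => Y i q.2) (fun i => X i q.2)
        (fun i => Z i q.2) (πhat q.1 q.2)) l (𝓝 (popV P (ε 0) (Z 0) π₀)) := by
  set U : ℕ → Ω → ℝ × Vec dx × Vec dz := fun i ω => (Y i ω, X i ω, Z i ω) with hU
  -- `W` carries the population first stage and serves as instrument; `R` carries `X` itself and
  -- enters the residual.
  let W : Coef dz dx → ℝ × Vec dx × Vec dz → ℝ := fun a u => stack u.2.2 (π₀ u.2.2) a
  let R : Coef dz dx → ℝ × Vec dx × Vec dz → ℝ := fun a u => stack u.2.2 u.2.1 a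
  let e : ℝ × Vec dx × Vec dz → ℝ := fun u => u.1 - ∑ a, R a u * θ₀ a
  have mW : ∀ a, Measurable (W a) := fun a =>
    measurable_stack (by fun_prop) (hπ₀m.comp (by fun_prop)) a
  have mR : ∀ a, Measurable (R a) := fun a => measurable_stack (by fun_prop) (by fun_prop) a
  have me : Measurable e := by fun_prop
  have hWL : ∀ a, MemLp (fun ω => W a (U 0 ω)) 4 P := fun a => memLp_stack hZ4 hπ₀4 a
  have hRL : ∀ a, MemLp (fun ω => R a (U 0 ω)) 4 P := fun a => memLp_stack hZ4 hX4 a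
  have heε : ∀ i ω, e (U i ω) = ε i ω := fun i ω => by rw [hε, regResidual_eq]
  have heL : MemLp (fun ω => e (U 0 ω)) 4 P := by simpa only [heε] using hε4
  have hYe : ∀ u : ℝ × Vec dx × Vec dz, u.1 = e u + ∑ a, R a u * θ₀ a := fun u => by simp [e]
  have hYL : MemLp (fun ω => (U 0 ω).1) 4 P := by
    simp only [hYe (U 0 _)]
    exact heL.add (memLp_finsetSum _ fun a _ => (hRL a).mul_const _)
  have h1L : MemLp (fun _ : Ω => (1 : ℝ)) 4 P := memLp_const 1
  have hself : ∀ f : ℝ × Vec dx × Vec dz → ℝ,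
      L4Null Prod.fst l fun (q : ℕ × Ω) i => f (U i q.2) - f (U i q.2) := fun f => by
    simpa using L4Null.zero
  let Wh : Coef dz dx → ℕ × Ω → ℕ → ℝ := fun a q i => stack (Z i q.2) (πhat q.1 q.2 (Z i q.2)) a
  have hWh : ∀ a, L4Null Prod.fst l fun q i => Wh a q i - W a (U i q.2) := by
    rintro (_ | j | k)
    · simpa [Wh, W, stack] using L4Null.zero
    · simpa [Wh, W, stack, hU] using L4Null.zero
    · simpa [Wh, W, stack, hU] using hπhat k
  have hSdet := Matrix.det_ne_zero_of_rank_eq_card hrank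
  have hSigma : Tendsto (fun q : ℕ × Ω => sigmaHat q.1 (fun i => Z i q.2) (πhat q.1 q.2)) l
      (𝓝 (popSigma P (Z 0) π₀)) := by
    refine tendsto_pi_nhds.2 fun a => tendsto_pi_nhds.2 fun b => ?_
    have h := tendsto_avg_mul_four_iid hindep hident hl (f₁ := fun _ => 1) (f₂ := fun _ => 1)
      measurable_const measurable_const (mW a) (mW b) h1L h1L (hWL a) (hWL b)
      (hself fun _ => 1) (hself fun _ => 1) (hWh a) (hWh b)
    simp only [one_mul] at h
    refine h.congr fun q => ?_
    rw [sigmaHat_apply]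
    simp [Wh]
  have hinv := hSigma.matrix_inv hSdet
  -- the population moment equation `E[W Y] = E[W W'] θ₀`
  have hXk : ∀ k, P[fun ω => X 0 ω k | MeasurableSpace.comap (Z 0) inferInstance]
      =ᵐ[P] fun ω => π₀ (Z 0 ω) k := fun k => by
    have h := ContinuousLinearMap.comp_condExp_comm (m := MeasurableSpace.comap (Z 0) inferInstance)
      (hX4.integrable (by norm_num)) (EuclideanSpace.proj (𝕜 := ℝ) k)
    filter_upwards [h, hπ₀] with ω h1 h2
    have h1' := h1.symm
    simp only [Function.comp_apply, h2] at h1'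
    exact h1'
  -- `W` is a function of `Z`, so `X` may be replaced by its conditional mean; the other coordinates
  -- of `R` and `W` coincide.
  have hWR : ∀ a b, ∫ ω, W a (U 0 ω) * R b (U 0 ω) ∂P = popSigma P (Z 0) π₀ a b := by
    intro a b
    simp only [popSigma, Matrix.of_apply]
    rcases b with _ | j | k
    · rfl
    · rfl
    · exact integral_comp_mul_of_condExp hZ (g := fun z => stack z (π₀ z) a)
        (h := fun z => π₀ z k) (measurable_stack measurable_id hπ₀m a)
        ((hRL (Sum.inr (Sum.inr k))).integrable (by norm_num))
        (((hWL a).mul_four (hRL (Sum.inr (Sum.inr k)))).integrable (by norm_num)) (hXk k)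
  have hWe : ∀ a, ∫ ω, W a (U 0 ω) * e (U 0 ω) ∂P = 0 := by
    intro a
    simp only [heε]
    have h := integral_comp_mul_of_condExp hZ (f := ε 0) (g := fun z => stack z (π₀ z) a)
      (h := fun _ => 0) (measurable_stack measurable_id hπ₀m a) (hε4.integrable (by norm_num))
      (((hWL a).mul_four hε4).integrable (by norm_num)) hexog
    simpa using h
  have hWY : ∀ a, ∫ ω, W a (U 0 ω) * (U 0 ω).1 ∂P = (popSigma P (Z 0) π₀).mulVec θ₀ a := by
    intro a
    have hi : ∀ b, Integrable (fun ω => W a (U 0 ω) * R b (U 0 ω)) P := fun b =>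
      ((hWL a).mul_four (hRL b)).integrable (by norm_num)
    have hsplit : ∀ ω, W a (U 0 ω) * (U 0 ω).1 =
        W a (U 0 ω) * e (U 0 ω) + ∑ b, W a (U 0 ω) * R b (U 0 ω) * θ₀ b := fun ω => by
      rw [hYe (U 0 ω), mul_add, Finset.mul_sum]
      simp only [mul_assoc]
    simp only [hsplit]
    rw [integral_add (((hWL a).mul_four heL).integrable (by norm_num))
      (integrable_finsetSum _ fun b _ => (hi b).mul_const _), hWe, zero_add,
      integral_finsetSum _ fun b _ => (hi b).mul_const _]
    simp only [integral_mul_const, hWR, Matrix.mulVec, dotProduct]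
  have hTheta : Tendsto (fun q : ℕ × Ω => thetaHat q.1 (fun i => Y i q.2) (fun i => Z i q.2)
      (πhat q.1 q.2)) l (𝓝 θ₀) := by
    have hv : Tendsto (fun q : ℕ × Ω => (q.1 : ℝ)⁻¹ • ∑ i ∈ Finset.range q.1,
        Y i q.2 • stack (Z i q.2) (πhat q.1 q.2 (Z i q.2))) l
        (𝓝 ((popSigma P (Z 0) π₀).mulVec θ₀)) := by
      refine tendsto_pi_nhds.2 fun a => ?_
      rw [← hWY]
      have h := tendsto_avg_mul_four_iid hindep hident hl (f₁ := fun _ => 1) (f₂ := fun _ => 1)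
        (f₄ := Prod.fst) measurable_const measurable_const (mW a) measurable_fst h1L h1L (hWL a)
        hYL (hself fun _ => 1) (hself fun _ => 1) (hWh a) (hself Prod.fst)
      simp only [one_mul] at h
      refine h.congr fun q => ?_
      simp [Wh, avg, hU, mul_comm]
    have hmul : Continuous fun p : Matrix (Coef dz dx) (Coef dz dx) ℝ × (Coef dz dx → ℝ) =>
        p.1.mulVec p.2 := continuous_fst.matrix_mulVec continuous_snd
    have h := (hmul.tendsto _).comp (hinv.prodMk_nhds hv)
    rw [Matrix.mulVec_mulVec, Matrix.nonsing_inv_mul _ hSdet.isUnit, Matrix.one_mulVec] at h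
    exact h
  -- The residual minus the error is linear in `θ₀ - θ̂`, with `L⁴`-bounded regressors as
  -- coefficients.
  have hEps : L4Null Prod.fst l fun (q : ℕ × Ω) i =>
      epsHat q.1 (fun i => Y i q.2) (fun i => X i q.2) (fun i => Z i q.2) (πhat q.1 q.2) i -
        e (U i q.2) := by
    have h := L4Null.sum (n := Prod.fst) (l := l) Finset.univ
      (a := fun a (q : ℕ × Ω) i => (θ₀ a - thetaHat q.1 (fun i => Y i q.2) (fun i => Z i q.2)
        (πhat q.1 q.2) a) * R a (U i q.2)) fun a _ =>
      (l4Bdd_of_iid hindep hident (mR a) (hRL a) hl).null_mul (by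
        have := (tendsto_pi_nhds.1 hTheta a).const_sub (θ₀ a)
        rwa [sub_self] at this)
    refine h.congr fun q => ?_
    congr 1
    ext i
    congr 1
    simp only [epsHat, regResidual_eq, e, R, hU]
    rw [sub_sub_sub_cancel_left, ← Finset.sum_sub_distrib]
    exact Finset.sum_congr rfl fun a _ => by ring
  have hOmega : Tendsto (fun q : ℕ × Ω => omegaHat q.1 (fun i => Y i q.2) (fun i => X i q.2)
      (fun i => Z i q.2) (πhat q.1 q.2)) l (𝓝 (popOmega P (ε 0) (Z 0) π₀)) := by
    refine tendsto_pi_nhds.2 fun a => tendsto_pi_nhds.2 fun b => ?_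
    have h := tendsto_avg_mul_four_iid hindep hident hl me me (mW a) (mW b) heL heL (hWL a)
      (hWL b) hEps hEps (hWh a) (hWh b)
    simp only [heε, ← sq] at h
    refine h.congr fun q => ?_
    rw [omegaHat_apply]
    simp only [sq, Wh]
  refine ⟨(hinv.mul hOmega).mul hinv, fun σsq hσ => ?_⟩
  have hvar : ∀ a b, ∫ ω, ε 0 ω ^ 2 * (W a (U 0 ω) * W b (U 0 ω)) ∂P =
      σsq * popSigma P (Z 0) π₀ a b := by
    intro a b
    have h := integral_comp_mul_of_condExp hZ (f := fun ω => ε 0 ω ^ 2)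
      (g := fun z => stack z (π₀ z) a * stack z (π₀ z) b)
      (h := fun _ => σsq)
      ((measurable_stack measurable_id hπ₀m a).mul (measurable_stack measurable_id hπ₀m b))
      (by simpa only [sq] using (hε4.mul_four hε4).integrable (by norm_num))
      (by simpa only [sq] using integrable_mul_four (hWL a) (hWL b) hε4 hε4) hσ
    simp only [popSigma, Matrix.of_apply]
    rw [integral_mul_const, mul_comm] at h
    rw [← h]
    simp only [mul_comm (ε 0 _ ^ 2)]
    rfl
  -- Under homoskedasticity the middle of the sandwich is a multiple of `Σ₀` and cancels one
  -- inverse.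
  have hOmegaEq : popOmega P (ε 0) (Z 0) π₀ = σsq • popSigma P (Z 0) π₀ := by
    ext a b
    exact hvar a b
  have hV : popV P (ε 0) (Z 0) π₀ = σsq • (popSigma P (Z 0) π₀)⁻¹ := by
    rw [popV, hOmegaEq, Matrix.mul_smul, Matrix.nonsing_inv_mul _ hSdet.isUnit, Matrix.smul_mul,
      Matrix.one_mul]
  have hs2 : Tendsto (fun q : ℕ × Ω => (q.1 : ℝ)⁻¹ * ∑ i ∈ Finset.range q.1,
      epsHat q.1 (fun i => Y i q.2) (fun i => X i q.2) (fun i => Z i q.2) (πhat q.1 q.2) i ^ 2) l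
      (𝓝 σsq) := by
    have h := tendsto_avg_mul_four_iid hindep hident hl (f₃ := fun _ => 1) (f₄ := fun _ => 1)
      me me measurable_const measurable_const heL heL h1L h1L hEps hEps (hself fun _ => 1)
      (hself fun _ => 1)
    have hσ' : ∫ ω, ε 0 ω ^ 2 ∂P = σsq := by
      rw [← integral_condExp hZ.comap_le, integral_congr_ae hσ]; simp
    simp only [heε, ← sq, one_pow, mul_one, hσ'] at h
    exact h
  rw [hV]
  exact hs2.smul hinv

end Consistency

/-! ### Stochastic orders and the main theorem -/

theorem tendsto_inProb_of_isLittleOInProb {Ω : Type*} [MeasurableSpace Ω] {P : Measure Ω}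
    {R : ℕ → Ω → ℝ≥0∞} {r : ℕ → ℝ} (h : IsLittleOInProb P R r) (hr : ∀ᶠ n in atTop, r n ≤ 1) :
    Tendsto (fun q : ℕ × Ω => R q.1 q.2) (inProb P) (𝓝 0) := by
  rw [ENNReal.tendsto_nhds_zero]
  intro δ hδ
  obtain ⟨c, hc, hcδ⟩ := ENNReal.lt_iff_exists_nnreal_btwn.1 hδ
  have hc' : (0 : ℝ) < c := by exact_mod_cast hc
  rw [eventually_inProb]
  refine tendsto_of_tendsto_of_tendsto_of_le_of_le' tendsto_const_nhds (h c hc')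
    (Eventually.of_forall fun _ => zero_le) ?_
  filter_upwards [hr] with n hn
  refine measure_mono fun ω hω => ?_
  have h1 : δ < R n ω := not_le.1 hω
  have h2 : ENNReal.ofReal (c * r n) ≤ c := by
    rw [← ENNReal.ofReal_coe_nnreal]
    exact ENNReal.ofReal_le_ofReal (mul_le_of_le_one_right hc'.le hn)
  exact h2.trans_lt (hcδ.trans h1)

/-- A finite family bounded in probability is bounded off an event of small probability. -/
theorem exists_uniform_bound_of_boundedInProb {Ω ι : Type*} [MeasurableSpace Ω] [Fintype ι]
    {P : Measure Ω} {R : ι → ℕ → Ω → ℝ≥0∞} (h : ∀ k, BoundedInProb P (R k)) {δ : ℝ≥0∞}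
    (hδ : 0 < δ) :
    ∃ M : ℝ≥0, ∀ᶠ n in atTop, P {ω | ∃ k, (M : ℝ≥0∞) < R k n ω} ≤ δ := by
  have hδ' : 0 < δ / (Fintype.card ι + 1 : ℝ≥0∞) :=
    ENNReal.div_pos hδ.ne' (by finiteness)
  choose M hM using fun k => h k _ hδ'
  refine ⟨∑ k, M k, ?_⟩
  filter_upwards [eventually_all.2 hM] with n hn
  have hsub : {ω | ∃ k, ((∑ k, M k : ℝ≥0) : ℝ≥0∞) < R k n ω} ⊆
      ⋃ k, {ω | (M k : ℝ≥0∞) < R k n ω} := by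
    rintro ω ⟨k, hk⟩
    refine Set.mem_iUnion.2 ⟨k, lt_of_le_of_lt ?_ hk⟩
    exact ENNReal.coe_le_coe.2 (Finset.single_le_sum (fun _ _ => zero_le) (Finset.mem_univ k))
  calc _ ≤ ∑ k, P {ω | (M k : ℝ≥0∞) < R k n ω} :=
        (measure_mono hsub).trans (measure_iUnion_fintype_le _ _)
    _ ≤ ∑ _k : ι, δ / (Fintype.card ι + 1 : ℝ≥0∞) := Finset.sum_le_sum fun k _ => hn k
    _ = Fintype.card ι * (δ / (Fintype.card ι + 1 : ℝ≥0∞)) := by simp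
    _ ≤ (Fintype.card ι + 1) * (δ / (Fintype.card ι + 1 : ℝ≥0∞)) := by gcongr; exact le_self_add
    _ ≤ δ := ENNReal.mul_div_le

theorem theorem3 {Ω : Type*} [MeasurableSpace Ω] (P : Measure Ω) [IsProbabilityMeasure P]
    {dz dx : ℕ}
    -- the observed data: an i.i.d. sequence `(Y_i, X_i, Z_i)`
    (Y : ℕ → Ω → ℝ) (X : ℕ → Ω → Vec dx) (Z : ℕ → Ω → Vec dz)
    (hY : ∀ i, Measurable (Y i)) (hX : ∀ i, Measurable (X i)) (hZ : ∀ i, Measurable (Z i))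
    (hindep : iIndepFun (fun i ω => (Y i ω, X i ω, Z i ω)) P)
    (hident : ∀ i, IdentDistrib (fun ω => (Y i ω, X i ω, Z i ω))
      (fun ω => (Y 0 ω, X 0 ω, Z 0 ω)) P P)
    -- the linear model: `ε_i = Y_i - α₀ - Z_i'β₀ - X_i'γ₀`
    (θ₀ : Coef dz dx → ℝ) (ε : ℕ → Ω → ℝ)
    (hε : ∀ i ω, ε i ω = regResidual θ₀ (Y i ω) (X i ω) (Z i ω))
    -- mean independence, `E[ε | Z] = 0`
    (hexog : P[ε 0 | MeasurableSpace.comap (Z 0) inferInstance] =ᵐ[P] 0)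
    -- `π₀(z) = E[X | Z = z]`
    (π₀ : Vec dz → Vec dx)
    (hπ₀ : P[X 0 | MeasurableSpace.comap (Z 0) inferInstance] =ᵐ[P] fun ω => π₀ (Z 0 ω))
    -- no multicollinearity: `E[W W']` has full rank
    (hrank : (popSigma P (Z 0) π₀).rank = Fintype.card (Coef dz dx))
    -- finite fourth moments
    (hε4 : MemLp (ε 0) 4 P) (hX4 : MemLp (X 0) 4 P) (hZ4 : MemLp (Z 0) 4 P)
    -- Sobolev smoothness of order `s > d_z / 2` of `π₀` on the support of `Z`
    (s : ℝ) (hs : (dz : ℝ) / 2 < s)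
    (hπ₀s : ∀ k, sobolevNormOn s (P.map (Z 0)).support (fun z => π₀ z k) < ⊤)
    -- the first-stage estimator: its Sobolev norm is `O_p(1)`, its `L₂(Z)` error `o_p(n^{-1/4})`
    (πhat : ℕ → Ω → Vec dz → Vec dx)
    (hπhats : ∀ k, BoundedInProb P
      (fun n ω => sobolevNormOn s (P.map (Z 0)).support (fun z => πhat n ω z k)))
    (hrate : IsLittleOInProb P
      (fun n ω => eLpNorm (fun z => πhat n ω z - π₀ z) 2 (P.map (Z 0)))
      (fun n => (n : ℝ) ^ (-(1 / 4) : ℝ))) :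
    MatrixTendstoInProb P
      (fun n ω => vHat n (fun i => Y i ω) (fun i => X i ω) (fun i => Z i ω) (πhat n ω))
      (popV P (ε 0) (Z 0) π₀)
    ∧ ∀ σsq : ℝ,
      P[fun ω => ε 0 ω ^ 2 | MeasurableSpace.comap (Z 0) inferInstance] =ᵐ[P] (fun _ => σsq) →
      MatrixTendstoInProb P
        (fun n ω => vHatHom n (fun i => Y i ω) (fun i => X i ω) (fun i => Z i ω) (πhat n ω))
        (popV P (ε 0) (Z 0) π₀) := by
  classical
  set S := (P.map (Z 0)).support with hS
  have : IsProbabilityMeasure (P.map (Z 0)) :=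
    Measure.isProbabilityMeasure_map (hZ 0).aemeasurable
  have hZindep : iIndepFun Z P :=
    hindep.comp (fun _ u => u.2.2) (fun _ => by fun_prop)
  have hZident : ∀ i, IdentDistrib (Z i) (Z 0) P P := fun i =>
    (hident i).comp (u := fun u : ℝ × Vec dx × Vec dz => u.2.2) (by fun_prop)
  have hZS : ∀ i, ∀ᵐ ω ∂P, Z i ω ∈ S := fun i => by
    refine ae_of_ae_map (hZ i).aemeasurable (p := fun z => z ∈ S) ?_
    rw [(hZident i).map_eq]
    exact Measure.support_mem_ae
  have hs' : (Module.finrank ℝ (Vec dz) : ℝ) < 2 * s := by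
    rw [finrank_euclideanSpace_fin]; linarith
  obtain ⟨C, hC, hext⟩ := exists_extension_of_sobolevNormOn_lt hs
  -- replace `π₀` by its bounded continuous extension
  have hM₀ : ∃ M₀ : ℝ, 0 ≤ M₀ ∧
      ∀ k, sobolevNormOn s S (fun z => π₀ z k) < ENNReal.ofReal M₀ := by
    refine ⟨∑ k, (sobolevNormOn s S (fun z => π₀ z k)).toReal + 1, by positivity, fun k => ?_⟩
    rw [ENNReal.lt_ofReal_iff_toReal_lt (hπ₀s k).ne]
    exact lt_of_le_of_lt (Finset.single_le_sum
      (f := fun k => (sobolevNormOn s S (fun z => π₀ z k)).toReal) (fun _ _ => by positivity)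
      (Finset.mem_univ k)) (lt_add_one _)
  obtain ⟨M₀, hM₀, hπ₀M⟩ := hM₀
  choose F₀ hF₀c hF₀S hF₀b hF₀m using fun k => hext S (fun z => π₀ z k) M₀ hM₀ (hπ₀M k)
  -- Unlike `π₀`, the extension is measurable everywhere and bounded; agreement on the support
  -- leaves the population matrices unchanged.
  let π₁ : Vec dz → Vec dx := fun z => WithLp.toLp 2 fun k => F₀ k z
  have hπ₁c : Continuous π₁ := by fun_prop
  have hπ₁S : ∀ z ∈ S, π₁ z = π₀ z := fun z hz => by
    ext k; exact hF₀S k z hz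
  have hπ₁ae : ∀ᵐ ω ∂P, π₀ (Z 0 ω) = π₁ (Z 0 ω) :=
    (hZS 0).mono fun ω hω => (hπ₁S _ hω).symm
  have hSig : popSigma P (Z 0) π₀ = popSigma P (Z 0) π₁ := by
    ext a b
    exact integral_congr_ae (hπ₁ae.mono fun ω hω => by simp only [hω])
  have hOm : popOmega P (ε 0) (Z 0) π₀ = popOmega P (ε 0) (Z 0) π₁ := by
    ext a b
    exact integral_congr_ae (hπ₁ae.mono fun ω hω => by simp only [hω])
  have hV : popV P (ε 0) (Z 0) π₀ = popV P (ε 0) (Z 0) π₁ := by rw [popV, popV, hSig, hOm]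
  have hπ₁4 : MemLp (fun ω => π₁ (Z 0 ω)) 4 P := by
    refine MemLp.of_bound (hπ₁c.measurable.comp (hZ 0)).aestronglyMeasurable
      (√(∑ _k : Fin dx, (C * M₀) ^ 2)) (ae_of_all _ fun ω => ?_)
    rw [EuclideanSpace.norm_eq]
    gcongr with k
    exact hF₀b k _
  have hL2 : Tendsto (fun q : ℕ × Ω =>
      eLpNorm (fun z => πhat q.1 q.2 z - π₀ z) 2 (P.map (Z 0))) (inProb P) (𝓝 0) := by
    have hr : ∀ᶠ n : ℕ in atTop, (n : ℝ) ^ (-(1 / 4) : ℝ) ≤ 1 := by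
      filter_upwards [eventually_ge_atTop 1] with n hn
      exact Real.rpow_le_one_of_one_le_of_nonpos (by exact_mod_cast hn) (by norm_num)
    have h := tendsto_inProb_of_isLittleOInProb hrate hr
    exact h
  have hmain : ∀ δ : ℝ≥0∞, 0 < δ → ∃ B : Set (ℕ × Ω),
      (∀ᶠ n in atTop, P {ω | (n, ω) ∈ B} ≤ δ) ∧ ∀ k, L4Null Prod.fst (inProb P ⊓ 𝓟 Bᶜ)
        fun q i => πhat q.1 q.2 (Z i q.2) k - π₁ (Z i q.2) k := by
    intro δ hδ
    obtain ⟨M, hM⟩ := exists_uniform_bound_of_boundedInProb hπhats hδ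
    refine ⟨{q | ∃ k, (M : ℝ≥0∞) < sobolevNormOn s S fun z => πhat q.1 q.2 z k}, hM, fun k => ?_⟩
    set B := {q : ℕ × Ω | ∃ k, (M : ℝ≥0∞) < sobolevNormOn s S fun z => πhat q.1 q.2 z k}
    set l := inProb P ⊓ 𝓟 Bᶜ
    have hl : l ≤ inProb P := inf_le_left
    -- `M + 1` makes the norm bound strict, as extension requires. Where the bound fails, `F` is a
    -- dummy zero.
    have hex : ∀ q : ℕ × Ω, ∃ F : Vec dz → ℝ,
        sobolevNormOn s S (fun z => πhat q.1 q.2 z k) < ENNReal.ofReal (M + 1) →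
        Continuous F ∧ (∀ z ∈ S, F z = πhat q.1 q.2 z k) ∧ (∀ z, |F z| ≤ C * (M + 1)) ∧
          ∀ z z', |F z - F z'| ≤ sobolevModulus s (z - z') * (M + 1) := fun q => by
      by_cases h : sobolevNormOn s S (fun z => πhat q.1 q.2 z k) < ENNReal.ofReal (M + 1)
      · obtain ⟨F, hF⟩ := hext S (fun z => πhat q.1 q.2 z k) (M + 1) (by positivity) h
        exact ⟨F, fun _ => hF⟩
      · exact ⟨0, fun h' => absurd h' h⟩
    choose F hF using hex
    have hlt : ∀ᶠ q in l, sobolevNormOn s S (fun z => πhat q.1 q.2 z k) <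
        ENNReal.ofReal (M + 1) := by
      filter_upwards [mem_inf_of_right (mem_principal_self Bᶜ)] with q hq
      refine (not_lt.1 fun h => hq ⟨k, h⟩ : _ ≤ (M : ℝ≥0∞)).trans_lt ?_
      rw [← ENNReal.ofReal_coe_nnreal]
      exact (ENNReal.ofReal_lt_ofReal_iff (by positivity)).2 (lt_add_one _)
    have hm : Tendsto (fun h : Vec dz => sobolevModulus s h * (M + 1 + M₀)) (𝓝 0) (𝓝 0) := by
      simpa using (tendsto_sobolevModulus hs').mul_const (M + 1 + M₀)
    have hG : ∀ᶠ q in l, Continuous (fun z => F q z - F₀ k z) ∧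
        (∀ z, |F q z - F₀ k z| ≤ C * (M + 1 + M₀)) ∧
        ∀ z z', |(F q z - F₀ k z) - (F q z' - F₀ k z')| ≤
          sobolevModulus s (z - z') * (M + 1 + M₀) := by
      filter_upwards [hlt] with q hq
      refine ⟨((hF q hq).1).sub (hF₀c k), fun z => ?_, fun z z' => ?_⟩
      · rw [mul_add]
        exact (abs_sub _ _).trans (add_le_add ((hF q hq).2.2.1 z) (hF₀b k z))
      · rw [mul_add, sub_sub_sub_comm]
        exact (abs_sub _ _).trans (add_le_add ((hF q hq).2.2.2 z z') (hF₀m k z z'))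
    have hGL2 : Tendsto (fun q => ∫ z, (F q z - F₀ k z) ^ 2 ∂(P.map (Z 0))) l (𝓝 0) := by
      have h0 : Tendsto (fun q => eLpNorm (fun z => F q z - F₀ k z) 2 (P.map (Z 0))) l (𝓝 0) := by
        refine tendsto_of_tendsto_of_tendsto_of_le_of_le' tendsto_const_nhds (hL2.mono_left hl)
          (Eventually.of_forall fun _ => zero_le) ?_
        filter_upwards [hlt] with q hq
        refine eLpNorm_mono_ae ?_
        filter_upwards [Measure.support_mem_ae (μ := P.map (Z 0))] with z hz
        rw [(hF q hq).2.1 z hz, hF₀S k z hz]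
        exact PiLp.norm_apply_le (πhat q.1 q.2 z - π₀ z) k
      have h1 := ((ENNReal.tendsto_toReal ENNReal.zero_ne_top).comp h0).pow 2
      simp only [ENNReal.toReal_zero, ne_eq, OfNat.ofNat_ne_zero, not_false_eq_true, zero_pow,
        Function.comp_apply] at h1
      refine h1.congr' ?_
      filter_upwards [hG] with q hq
      have hmem : MemLp (fun z => F q z - F₀ k z) 2 (P.map (Z 0)) :=
        MemLp.of_bound hq.1.aestronglyMeasurable _ (ae_of_all _ hq.2.1)
      rw [hmem.eLpNorm_eq_integral_rpow_norm (by norm_num) (by norm_num),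
        ENNReal.toReal_ofReal (by positivity), ← Real.rpow_mul_natCast (by positivity)]
      simp
    have h := l4Null_of_equicontinuous hZindep hZident (hZ 0) hl hm hG hGL2
    refine h.congr' ?_
    -- Almost surely all observations lie in the support, where the extensions equal the original
    -- functions.
    filter_upwards [hlt, hl (eventually_inProb_of_ae (ae_all_iff.2 hZS))] with q hq hqS
    congr 1
    ext i
    congr 1
    rw [(hF q hq).2.1 _ (hqS i)]
  have hlocal := fun {l : Filter (ℕ × Ω)} (hl : l ≤ inProb P) => tendsto_vHat_of_l4Null Y X Z (hZ 0)
    hindep hident θ₀ ε hε hexog π₁ hπ₁c.measurable hπ₁4 (hπ₀.trans hπ₁ae) (hSig ▸ hrank) hε4 hX4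
    hZ4 πhat hl
  rw [hV]
  refine ⟨fun a b => ?_, fun σsq hσ a b => ?_⟩ <;> rw [tendstoInMeasure_const_iff] <;>
    refine tendsto_inProb_of_localized fun δ hδ => ?_ <;>
    obtain ⟨B, hB, hnull⟩ := hmain δ hδ <;> refine ⟨B, hB, ?_⟩
  · exact tendsto_pi_nhds.1 (tendsto_pi_nhds.1 (hlocal inf_le_left hnull).1 a) b
  · exact tendsto_pi_nhds.1 (tendsto_pi_nhds.1 ((hlocal inf_le_left hnull).2 σsq hσ) a) b
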